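/- All rings have an identity. A commutative ring $R$ is projective-free if every finitely generated projective $R$-module is free. For a ring $S$ with Jacobson radical $J(S)$ put $J^{\#}(S)=\{s\in S \mid s^n\in J(S)\text{ for some integer } n\ge 1\}$; an element $a\in S$ is strongly $J^{\#}$-clean if there is an idempotent $e\in S$ with $ea=ae$ and $a-e\in J^{\#}(S)$. **Theorem 3.4.** Let $R$ be a projective-free ring, let $A(x)=(a_{ij}(x))\in M_3(R[[x]])$, and let $m\ge 1$ be an integer. Then the following are equivalent: 1. $A(x)$ is strongly $J^{\#}$-clean in $M_3(R[[x]])$. 2. The image of $A(x)$ in $M_3\big(R[[x]]/(x^m)\big)$ is strongly $J^{\#}$-clean. 3. $A(0)=(a_{ij}(0))$ is strongly $J^{\#}$-clean in $M_3(R)$. -/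

import Mathlib

universe u

/-- The set `J^#(R)` of elements of a (not necessarily commutative) ring `R` some power of which
lies in the Jacobson radical of `R`. -/
def JSharp (R : Type u) [Ring R] : Set R :=
  {x | ∃ n : ℕ, 1 ≤ n ∧ x ^ n ∈ Ring.jacobson R}

/-- An element `a` of a ring is strongly `J^#`-clean if there is an idempotent `e`, commuting
with `a`, such that `a - e` lies in `J^#(R)`. -/
def IsStronglyJSharpClean {R : Type u} [Ring R] (a : R) : Prop :=
  ∃ e : R, IsIdempotentElem e ∧ a - e ∈ JSharp R ∧ e * a = a * e

/-- A commutative ring is projective-free if every finitely generated projective module over it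
is free. Since a finitely generated module is isomorphic to a quotient of some `R ^ n`, it is
enough to let the modules range over the universe of `R`. -/
def IsProjectiveFree (R : Type u) [CommRing R] : Prop :=
  ∀ (P : Type u) [AddCommGroup P] [Module R P],
    Module.Finite R P → Module.Projective R P → Module.Free R P

/-!
Reduction of coefficients is surjective, so strong `J^#`-cleanness passes from `A` to its truncation
and on to `A(0)`. The point is to lift it back from `A(0)` along the complete ring `R[[x]]`.

Let `E` be an idempotent commuting with a matrix `A` over a commutative ring, with `N = A - E` in
`J^#`, and let `χ` be the characteristic polynomial of `N`. Modulo the Jacobson radical `N` is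
nilpotent, so `χ` reduces to a power of `t` and is coprime to `χ(t - 1)`; as the resultant of the
two polynomials is then a unit, they are already coprime: `u χ + v χ(t - 1) = 1`. By Cayley–Hamilton
`(1 - E) χ(A) = 0` and `E χ(A - 1) = 0`, hence `E = (u χ)(A)` is a polynomial in `A`.

Lifting the coefficients of this polynomial to `R[[x]]` gives a matrix that commutes with `A` and is
idempotent modulo `x`. By completeness it can be corrected to an idempotent still commuting with
`A`, and membership in `J^#` lifts because `x` lies in the Jacobson radical.
-/

section JSharp

universe v

variable {S : Type u} {T : Type v} [Ring S] [Ring T]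

theorem JSharp.map_mem {f : S →+* T} (hf : Function.Surjective f) {a : S} (ha : a ∈ JSharp S) :
    f a ∈ JSharp T := by
  obtain ⟨k, hk, hak⟩ := ha
  have : RingHomSurjective f := ⟨hf⟩
  exact ⟨k, hk, map_pow f a k ▸ Ring.le_comap_jacobson f hak⟩

theorem JSharp.of_map_mem {f : S →+* T} (hf : Function.Surjective f)
    (hker : RingHom.ker f ≤ Ring.jacobson S) {a : S} (ha : f a ∈ JSharp T) : a ∈ JSharp S := by
  obtain ⟨k, hk, hak⟩ := ha
  have : RingHomSurjective f := ⟨hf⟩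
  refine ⟨k, hk, ?_⟩
  rw [← map_pow] at hak
  exact (Module.comap_jacobson_of_ker_le (f := f.toSemilinearMap) hf hker).le hak

theorem IsStronglyJSharpClean.map {f : S →+* T} (hf : Function.Surjective f) {a : S}
    (ha : IsStronglyJSharpClean a) : IsStronglyJSharpClean (f a) := by
  obtain ⟨e, he, hae, hcomm⟩ := ha
  exact ⟨f e, he.map f, map_sub f a e ▸ JSharp.map_mem hf hae, (show Commute e a from hcomm).map f⟩

end JSharp

section Matrix

variable {n : Type*} [Fintype n] [DecidableEq n]

theorem matrix_mem_jacobson_iff {R : Type*} [Ring R] {M : Matrix n n R} :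
    M ∈ Ring.jacobson (Matrix n n R) ↔ ∀ i j, M i j ∈ Ring.jacobson R := by
  have h := SetLike.ext_iff.1 (TwoSidedIdeal.matrix_jacobson_bot (R := R) (n := n)) M
  rw [TwoSidedIdeal.mem_matrix] at h
  simp only [← TwoSidedIdeal.mem_asIdeal, TwoSidedIdeal.asIdeal_jacobson,
    TwoSidedIdeal.bot_asIdeal, Ideal.jacobson_bot] at h
  exact h.symm

theorem mapMatrix_surjective {R S : Type*} [NonAssocSemiring R] [NonAssocSemiring S] {f : R →+* S}
    (hf : Function.Surjective f) : Function.Surjective (f.mapMatrix (m := n)) := by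
  intro M
  choose g hg using hf
  exact ⟨M.map g, by ext; simp [hg]⟩

theorem JSharp.of_mapMatrix_mem {R S : Type*} [Ring R] [Ring S] {f : R →+* S}
    (hf : Function.Surjective f) (hker : RingHom.ker f ≤ Ring.jacobson R) {M : Matrix n n R}
    (hM : f.mapMatrix M ∈ JSharp (Matrix n n S)) : M ∈ JSharp (Matrix n n R) := by
  have hkerM : RingHom.ker (f.mapMatrix (m := n)) ≤ Ring.jacobson (Matrix n n R) :=
    fun _ hN ↦ matrix_mem_jacobson_iff.2 fun i j ↦ hker (congrFun₂ hN i j)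
  exact JSharp.of_map_mem (mapMatrix_surjective hf) hkerM hM

end Matrix

section Aeval

open Polynomial

variable {R S : Type*} [CommSemiring R]

theorem commute_aeval [Semiring S] [Algebra R S] {a b : S} (hab : Commute a b) (p : R[X]) :
    Commute a (aeval b p) :=
  Algebra.commute_of_mem_adjoin_singleton_of_commute (aeval_mem_adjoin_singleton R b) hab

theorem mul_aeval_eq_mul_aeval [Semiring S] [Algebra R S] {e x y : S} (hey : Commute e y)
    (h : e * x = e * y) (p : R[X]) :
    e * aeval x p = e * aeval y p := by
  have hpow (k : ℕ) : e * x ^ k = e * y ^ k := by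
    induction k with
    | zero => simp only [pow_zero]
    | succ k ih =>
      calc e * x ^ (k + 1) = y * (e * x ^ k) := by
            rw [pow_succ', ← mul_assoc, h, hey.eq, mul_assoc]
        _ = e * y ^ (k + 1) := by rw [ih, ← mul_assoc, ← hey.eq, mul_assoc, ← pow_succ']
  simp only [aeval_eq_sum_range, Finset.mul_sum, mul_smul_comm, hpow]

theorem mapMatrix_aeval {n : Type*} [Fintype n] [DecidableEq n] [CommSemiring S] (f : R →+* S)
    (A : Matrix n n R) (p : R[X]) :
    f.mapMatrix (aeval A p) = aeval (f.mapMatrix A) (p.map f) :=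
  map_aeval_eq_aeval_map (by ext; simp [Matrix.algebraMap_matrix_apply, apply_ite f]) p A

end Aeval

section Coprime

open Polynomial

theorem isCoprime_of_isCoprime_map {R S : Type*} [CommRing R] [CommRing S] (φ : R →+* S)
    [IsLocalHom φ] {f g : R[X]} (hf : f.Monic) (h : IsCoprime (f.map φ) (g.map φ)) :
    IsCoprime f g := by
  rw [← isUnit_resultant_iff_isCoprime hf]
  refine IsUnit.of_map φ _ ?_
  cases subsingleton_or_nontrivial S
  · exact isUnit_of_subsingleton _
  -- `g.map φ` may have smaller degree than `g`; as `f` is monic, padding it with zero leading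
  -- coefficients does not change the resultant.
  obtain ⟨k, hk⟩ := Nat.exists_eq_add_of_le (natDegree_map_le (f := φ) (p := g))
  have hres := resultant_add_right_deg (f.map φ) (g.map φ) f.natDegree (g.map φ).natDegree k le_rfl
  rw [← hk, resultant_map_map, coeff_map, hf.coeff_natDegree, map_one, one_pow, one_mul] at hres
  rw [hres]
  simpa only [hf.natDegree_map φ] using (isUnit_resultant_iff_isCoprime (hf.map φ)).2 h

variable {n : Type*} [Fintype n] [DecidableEq n] {R : Type*} [CommRing R]

theorem charpoly_map_mk_jacobson {N : Matrix n n R} (hN : N ∈ JSharp (Matrix n n R)) :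
    N.charpoly.map (Ideal.Quotient.mk (Ring.jacobson R)) = X ^ Fintype.card n := by
  obtain ⟨k, -, hk⟩ := hN
  have : IsReduced (R ⧸ Ring.jacobson R) := by
    rw [← Ideal.isRadical_iff_quotient_reduced, ← Ideal.jacobson_bot]
    exact Ideal.isRadical_jacobson _
  have hnil : IsNilpotent (N.map (Ideal.Quotient.mk (Ring.jacobson R))) := by
    refine ⟨k, ?_⟩
    rw [← RingHom.mapMatrix_apply, ← map_pow]
    ext i j
    exact Ideal.Quotient.eq_zero_iff_mem.2 (matrix_mem_jacobson_iff.1 hk i j)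
  rw [← Matrix.charpoly_map, ← sub_eq_zero]
  ext i
  exact (Polynomial.isNilpotent_iff.1
    (Matrix.isNilpotent_charpoly_sub_pow_of_isNilpotent hnil) i).eq_zero

theorem isCoprime_charpoly_comp_X_sub_one {N : Matrix n n R} (hN : N ∈ JSharp (Matrix n n R)) :
    IsCoprime N.charpoly (N.charpoly.comp (X - 1)) := by
  have : IsLocalHom (Ideal.Quotient.mk (Ring.jacobson R)) :=
    isLocalHom_of_le_jacobson_bot _ (Ideal.jacobson_bot (R := R)).ge
  refine isCoprime_of_isCoprime_map (Ideal.Quotient.mk (Ring.jacobson R)) N.charpoly_monic ?_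
  have hX : IsCoprime (X : (R ⧸ Ring.jacobson R)[X]) (X - 1) := ⟨1, -1, by ring⟩
  simpa [map_comp, charpoly_map_mk_jacobson hN] using hX.pow

theorem exists_aeval_eq_of_sub_mem_JSharp {A E : Matrix n n R} (hE : IsIdempotentElem E)
    (hEA : Commute E A) (hN : A - E ∈ JSharp (Matrix n n R)) : ∃ p : R[X], aeval A p = E := by
  set f := (A - E).charpoly
  set g := f.comp (X - 1)
  obtain ⟨u, v, huv⟩ : IsCoprime f g := isCoprime_charpoly_comp_X_sub_one hN
  have hEN : Commute E (A - E) := hEA.sub_right (Commute.refl E)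
  have hCH : aeval (A - E) f = 0 := Matrix.aeval_self_charpoly _
  have hf : (1 - E) * aeval A f = 0 := by
    have hA : (1 - E) * A = (1 - E) * (A - E) := by rw [mul_sub, hE.one_sub_mul_self, sub_zero]
    rw [mul_aeval_eq_mul_aeval ((Commute.one_left _).sub_left hEN) hA, hCH, mul_zero]
  have hg : E * aeval A g = 0 := by
    have hA : E * (A - 1) = E * (A - E) := by rw [mul_sub, mul_sub, mul_one, hE.eq]
    have hgA : aeval A g = aeval (A - 1) f := by simp [g, aeval_comp]
    rw [hgA, mul_aeval_eq_mul_aeval hEN hA, hCH, mul_zero]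
  refine ⟨f * u, ?_⟩
  have hsum : aeval A (f * u) + aeval A (g * v) = 1 := by
    rw [← map_add, mul_comm f, mul_comm g, huv, map_one]
  calc aeval A (f * u)
      = E * aeval A (f * u) + (1 - E) * aeval A f * aeval A u := by
        rw [mul_assoc, ← map_mul]
        noncomm_ring
    _ = E * (aeval A (f * u) + aeval A (g * v)) := by
        rw [hf, zero_mul, mul_add, map_mul _ g, ← mul_assoc E _ (aeval A v), hg, zero_mul]
    _ = E := by rw [hsum, mul_one]

end Coprime

section Lifting

open Polynomial

variable {K : Type*} [CommRing K]

variable (K) in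
/-- The polynomial `1 - (1 - X ^ k) ^ k`. It is divisible by `X ^ k` and congruent to `1` modulo
`(X - 1) ^ k`, so its values at an element `b` with `b * b - b` topologically nilpotent converge to
an idempotent as `k` grows; for `k = 1` it is `X`. -/
noncomputable def idempotentApprox (k : ℕ) : K[X] :=
  1 - (1 - X ^ k) ^ k

theorem X_pow_dvd_idempotentApprox (k : ℕ) : X ^ k ∣ idempotentApprox K k := by
  have h := sub_dvd_pow_sub_pow (1 : K[X]) (1 - X ^ k) k
  rwa [sub_sub_cancel, one_pow] at h

theorem X_sub_one_pow_dvd_idempotentApprox_sub_one (k : ℕ) :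
    (X - 1) ^ k ∣ idempotentApprox K k - 1 := by
  have h : (X - 1 : K[X]) ∣ 1 - X ^ k :=
    dvd_sub_comm.1 (by simpa using sub_dvd_pow_sub_pow (X : K[X]) 1 k)
  simpa [idempotentApprox] using pow_dvd_pow_of_dvd h k

theorem X_mul_X_sub_one_pow_dvd {k : ℕ} {p : K[X]} (h₀ : X ^ k ∣ p)
    (h₁ : (X - 1) ^ k ∣ p) : (X * (X - 1)) ^ k ∣ p := by
  rw [mul_pow]
  exact IsCoprime.mul_dvd (IsCoprime.pow ⟨1, -1, by ring⟩) h₀ h₁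

theorem dvd_idempotentApprox_sub {k l : ℕ} (hkl : k ≤ l) :
    (X * (X - 1)) ^ k ∣ idempotentApprox K k - idempotentApprox K l := by
  have h₀ := (pow_dvd_pow (X : K[X]) hkl).trans (X_pow_dvd_idempotentApprox l)
  have h₁ := (pow_dvd_pow (X - 1 : K[X]) hkl).trans
    (X_sub_one_pow_dvd_idempotentApprox_sub_one l)
  refine X_mul_X_sub_one_pow_dvd (dvd_sub (X_pow_dvd_idempotentApprox k) h₀) ?_
  rw [← sub_sub_sub_cancel_right (idempotentApprox K k) (idempotentApprox K l) 1]
  exact dvd_sub (X_sub_one_pow_dvd_idempotentApprox_sub_one k) h₁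

theorem dvd_idempotentApprox_mul_self_sub (k : ℕ) :
    (X * (X - 1)) ^ k ∣ idempotentApprox K k * idempotentApprox K k - idempotentApprox K k := by
  rw [← mul_sub_one, mul_pow]
  exact mul_dvd_mul (X_pow_dvd_idempotentApprox k) (X_sub_one_pow_dvd_idempotentApprox_sub_one k)

variable {S : Type*} [Ring S] [Algebra K S] {I : Ideal K}

theorem aeval_mem_pow_smul_top {b : S} (hb : b * b - b ∈ (I • ⊤ : Submodule K S)) {k : ℕ}
    {p : K[X]} (hp : (X * (X - 1)) ^ k ∣ p) : aeval b p ∈ (I ^ k • ⊤ : Submodule K S) := by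
  obtain ⟨q, rfl⟩ := hp
  have hpow : (b * b - b) ^ k ∈ (I ^ k • ⊤ : Submodule K S) := by
    have h := Submodule.pow_mem_pow _ hb k
    rw [_root_.smul_pow] at h
    exact smul_mono_right (I ^ k) (le_top (a := (⊤ : Submodule K S) ^ k)) h
  have h := Submodule.smul_top_le_comap_smul_top (I ^ k) (LinearMap.mulRight K (aeval b q)) hpow
  simpa [mul_sub] using h

theorem exists_isIdempotentElem_sub_mem [IsAdicComplete I S] {b : S}
    (hb : b * b - b ∈ (I • ⊤ : Submodule K S)) :
    ∃ e : S, IsIdempotentElem e ∧ e - b ∈ (I • ⊤ : Submodule K S) ∧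
      ∀ a, Commute a b → Commute a e := by
  let e' (k : ℕ) : S := aeval b (idempotentApprox K k)
  obtain ⟨e, he⟩ : ∃ e, ∀ k, e' k ≡ e [SMOD (I ^ k • ⊤ : Submodule K S)] := by
    refine IsPrecomplete.prec inferInstance fun hkl ↦ SModEq.sub_mem.2 ?_
    rw [← map_sub]
    exact aeval_mem_pow_smul_top hb (dvd_idempotentApprox_sub hkl)
  have hmap (φ : S →ₗ[K] S) (k : ℕ) : φ (e' k - e) ∈ (I ^ k • ⊤ : Submodule K S) :=
    Submodule.smul_top_le_comap_smul_top _ φ (SModEq.sub_mem.1 (he k))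
  have heq {x y : S} (h : ∀ k, x - y ∈ (I ^ k • ⊤ : Submodule K S)) : x = y :=
    sub_eq_zero.1 (IsHausdorff.haus' (I := I) _ fun k ↦ SModEq.zero.2 (h k))
  refine ⟨e, heq fun k ↦ ?_, ?_, fun a hab ↦ heq fun k ↦ ?_⟩
  · have hidem : e' k * e' k - e' k ∈ (I ^ k • ⊤ : Submodule K S) := by
      simpa [e'] using aeval_mem_pow_smul_top hb (dvd_idempotentApprox_mul_self_sub k)
    have hsplit : e * e - e = (e' k * e' k - e' k) + (e' k - e)
        - (e' k * (e' k - e) + (e' k - e) * e) := by noncomm_ring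
    rw [hsplit]
    exact sub_mem (add_mem hidem (hmap .id k))
      (add_mem (hmap (LinearMap.mulLeft K (e' k)) k) (hmap (LinearMap.mulRight K e) k))
  · have h := SModEq.sub_mem.1 (he 1).symm
    simpa [e', idempotentApprox] using h
  · have hk : Commute a (e' k) := commute_aeval hab _
    have h := hmap (LinearMap.mulRight K a - LinearMap.mulLeft K a) k
    simpa [mul_sub, sub_mul, hk.eq] using h

theorem isAdicComplete_pi {ι : Type*} [Finite ι] (M : ι → Type*) [∀ i, AddCommGroup (M i)]
    [∀ i, Module K (M i)] [∀ i, IsAdicComplete I (M i)] : IsAdicComplete I (∀ i, M i) := by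
  classical
  have := Fintype.ofFinite ι
  rw [← AdicCompletion.of_bijective_iff,
    ← (AdicCompletion.piEquivOfFintype I M).bijective.of_comp_iff']
  convert! Function.Bijective.piMap fun i ↦ AdicCompletion.of_bijective I (M i) using 1

theorem isAdicComplete_matrix {m n : Type*} [Finite m] [Finite n] [IsAdicComplete I K] :
    IsAdicComplete I (Matrix m n K) :=
  have : IsAdicComplete I (n → K) := isAdicComplete_pi fun _ ↦ K
  isAdicComplete_pi fun _ ↦ n → K

theorem matrix_mem_smul_top_iff {m n : Type*} [Finite m] [Finite n] {M : Matrix m n K} :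
    M ∈ (I • ⊤ : Submodule K (Matrix m n K)) ↔ ∀ i j, M i j ∈ I := by
  classical
  have := Fintype.ofFinite m
  have := Fintype.ofFinite n
  refine ⟨fun hM i j ↦ ?_, fun hM ↦ ?_⟩
  · simpa using Submodule.smul_top_le_comap_smul_top I (Matrix.entryLinearMap K K i j) hM
  · rw [M.matrix_eq_sum_single]
    refine sum_mem fun i _ ↦ sum_mem fun j _ ↦ ?_
    rw [← mul_one (M i j), ← smul_eq_mul, ← Matrix.smul_single]
    exact Submodule.smul_mem_smul (hM i j) trivial

variable {n : Type*} [Fintype n] [DecidableEq n]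

theorem exists_isIdempotentElem_mapMatrix_eq {R : Type*} [CommRing R] {f : K →+* R}
    [IsAdicComplete (RingHom.ker f) K] {B : Matrix n n K}
    (hB : IsIdempotentElem (f.mapMatrix B)) :
    ∃ E : Matrix n n K, IsIdempotentElem E ∧ f.mapMatrix E = f.mapMatrix B ∧
      ∀ A, Commute A B → Commute A E := by
  have : IsAdicComplete (RingHom.ker f) (Matrix n n K) := isAdicComplete_matrix
  have hmem {M : Matrix n n K} :
      M ∈ (RingHom.ker f • ⊤ : Submodule K (Matrix n n K)) ↔ f.mapMatrix M = 0 := by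
    rw [matrix_mem_smul_top_iff, ← Matrix.ext_iff]
    rfl
  have hsq : B * B - B ∈ (RingHom.ker f • ⊤ : Submodule K (Matrix n n K)) := by
    rw [hmem, map_sub, map_mul, hB.eq, sub_self]
  obtain ⟨E, hE, hEB, hcomm⟩ := exists_isIdempotentElem_sub_mem hsq
  rw [hmem, map_sub, sub_eq_zero] at hEB
  exact ⟨E, hE, hEB, hcomm⟩

theorem IsStronglyJSharpClean.of_mapMatrix {R : Type*} [CommRing R] {f : K →+* R}
    (hf : Function.Surjective f) [IsAdicComplete (RingHom.ker f) K] {A : Matrix n n K}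
    (h : IsStronglyJSharpClean (f.mapMatrix A)) : IsStronglyJSharpClean A := by
  have hker : RingHom.ker f ≤ Ring.jacobson K :=
    (IsAdicComplete.le_jacobson_bot _).trans Ideal.jacobson_bot.le
  obtain ⟨E₀, hE₀, hAE₀, hcomm₀⟩ := h
  obtain ⟨p₀, hp₀⟩ := exists_aeval_eq_of_sub_mem_JSharp hE₀ hcomm₀ hAE₀
  obtain ⟨p, rfl⟩ := map_surjective f hf p₀
  rw [← mapMatrix_aeval] at hp₀
  obtain ⟨E, hE, hEp, hcomm⟩ := exists_isIdempotentElem_mapMatrix_eq (hp₀ ▸ hE₀)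
  have hAE : f.mapMatrix (A - E) ∈ JSharp (Matrix n n R) := by rwa [map_sub, hEp, hp₀]
  exact ⟨E, hE, JSharp.of_mapMatrix_mem hf hker hAE,
    (hcomm A (commute_aeval (Commute.refl A) p)).symm⟩

end Lifting

theorem ker_constantCoeff_eq_span_X {R : Type*} [CommSemiring R] :
    RingHom.ker (PowerSeries.constantCoeff (R := R)) = Ideal.span {PowerSeries.X} := by
  ext φ
  rw [RingHom.mem_ker, Ideal.mem_span_singleton, PowerSeries.X_dvd_iff]

theorem theorem3p4_general {R : Type u} [CommRing R] {n : Type*} [Fintype n] [DecidableEq n]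
    (A : Matrix n n (PowerSeries R)) (m : ℕ) (hm : 1 ≤ m) :
    List.TFAE [
      IsStronglyJSharpClean A,
      IsStronglyJSharpClean
        (A.map (Ideal.Quotient.mk (Ideal.span {(PowerSeries.X : PowerSeries R) ^ m}))),
      IsStronglyJSharpClean (A.map (PowerSeries.constantCoeff (R := R)))] := by
  have hsurj : Function.Surjective (PowerSeries.constantCoeff (R := R)) :=
    PowerSeries.constantCoeff_surj
  tfae_have 1 → 2 := fun h ↦ h.map (mapMatrix_surjective Ideal.Quotient.mk_surjective)
  tfae_have 2 → 3 := by
    have hker : ∀ φ ∈ Ideal.span {(PowerSeries.X : PowerSeries R) ^ m},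
        PowerSeries.constantCoeff φ = 0 := fun φ hφ ↦
      PowerSeries.X_dvd_iff.1
        ((dvd_pow_self _ (Nat.one_le_iff_ne_zero.1 hm)).trans (Ideal.mem_span_singleton.1 hφ))
    exact fun h ↦ h.map (mapMatrix_surjective
      (Ideal.Quotient.lift_surjective_of_surjective _ hker hsurj))
  tfae_have 3 → 1 := by
    have : IsAdicComplete (RingHom.ker (PowerSeries.constantCoeff (R := R))) (PowerSeries R) := by
      rw [ker_constantCoeff_eq_span_X]
      infer_instance
    exact IsStronglyJSharpClean.of_mapMatrix hsurj
  tfae_finish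

theorem theorem3p4 {R : Type u} [CommRing R] (hR : IsProjectiveFree R)
    (A : Matrix (Fin 3) (Fin 3) (PowerSeries R)) (m : ℕ) (hm : 1 ≤ m) :
    List.TFAE [
      IsStronglyJSharpClean A,
      IsStronglyJSharpClean
        (A.map (Ideal.Quotient.mk (Ideal.span {(PowerSeries.X : PowerSeries R) ^ m}))),
      IsStronglyJSharpClean (A.map (PowerSeries.constantCoeff (R := R)))] :=
  theorem3p4_general A m hm
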